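/- Let \(\mathcal G=(V,E)\) be a non-oriented, locally finite, connected graph without loops, with conductances \(W_{i,j}=W_{j,i}>0\) on the edges \(\{i,j\}\in E\). Write \(i\sim j\) if \(\{i,j\}\in E\), let \(W_i=\sum_{j\sim i}W_{i,j}\), and let \(d_{\mathcal G}(U,U')=\inf_{i\in U,\,j\in U'}d_{\mathcal G}(i,j)\), where \(d_{\mathcal G}\) is the graph distance. Sums over \(i\sim j\) below run over non-oriented edges, each counted once. There exists a family \((\beta_i)_{i\in V}\) of (almost surely) positive random variables such that, for every finite \(U\subset V\) and all \((\lambda_i)_{i\in U}\in[0,\infty)^U\), \[ \mathbb E\Big(e^{-\sum_{i\in U}\lambda_i\beta_i}\Big)= \exp\Big(-\sum_{i\sim j,\ i,j\in U}W_{i,j}\big(\sqrt{(1+\lambda_i)(1+\lambda_j)}-1\big)-\sum_{i\sim j,\ i\in U,\,j\notin U}W_{i,j}\big(\sqrt{1+\lambda_i}-1\big)\Big)\frac{1}{\prod_{i\in U}\sqrt{1+\lambda_i}} . \] The law \(\nu_V^W\) on \(\mathbb R^V\) of such a family is uniquely determined. Moreover, every such family has the following properties. (1) It is 1-dependent: if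 \(U,U'\subset V\) (finite or infinite) satisfy \(d_{\mathcal G}(U,U')\ge 2\), then \((\beta_i)_{i\in U}\) and \((\beta_j)_{j\in U'}\) are independent. (2) For every \(i\in V\) that has at least one neighbour (that is, for every \(i\), unless \(V\) is a single point), \(\frac1{2\beta_i}\) has the Inverse Gaussian law with parameters \((\frac1{W_i},1)\), where the Inverse Gaussian law with parameters \((\mu,\lambda)\) has density \(\sqrt{\frac{\lambda}{2\pi x^3}}\,\exp\big(-\frac{\lambda(x-\mu)^2}{2\mu^2x}\big)\) on \((0,\infty)\). -/

import Mathlib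

open MeasureTheory ProbabilityTheory

universe u v

namespace BetaField

noncomputable section

/-- Density of the inverse Gaussian law with parameters `(m, l)` (`m > 0` is the mean and `l > 0`
the shape): `√(l / (2 π x³)) exp (-l (x - m)² / (2 m² x))` on `x > 0`, and `0` elsewhere. -/
def inverseGaussianPDFReal (m l x : ℝ) : ℝ :=
  if 0 < x then
    Real.sqrt (l / (2 * Real.pi * x ^ 3)) * Real.exp (-(l * (x - m) ^ 2 / (2 * m ^ 2 * x)))
  else 0

/-- The inverse Gaussian law with parameters `(m, l)`, as a measure on `ℝ`. -/
def inverseGaussianMeasure (m l : ℝ) : Measure ℝ :=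
  volume.withDensity (fun x => ENNReal.ofReal (inverseGaussianPDFReal m l x))

variable {V : Type u} (G : SimpleGraph V)

/-- The distance between two sets of vertices, `inf_{i ∈ U, j ∈ U'} d(i, j)`, where `d` is the graph
distance (it is `⊤` if one of the two sets is empty). -/
def setDist (U U' : Set V) : ℕ∞ :=
  ⨅ i ∈ U, ⨅ j ∈ U', G.edist i j

/-- The function `{i, j} ↦ √((1 + t i) (1 + t j))` on unordered pairs. -/
def pairSqrt (t : V → ℝ) : Sym2 V → ℝ :=
  Sym2.lift ⟨fun i j => Real.sqrt ((1 + t i) * (1 + t j)), fun i j => by simp only [mul_comm]⟩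

open Classical in
/-- `∑_{i ∼ j, i, j ∈ U} W_{i,j} (√((1 + t i) (1 + t j)) - 1)`, each unoriented edge being counted
once. -/
def innerEnergy (W : Sym2 V → ℝ) (U : Finset V) (t : V → ℝ) : ℝ :=
  ∑ e ∈ U.sym2 with e ∈ G.edgeSet, W e * (pairSqrt t e - 1)

/-- 1-dependence: the restrictions of the field to two sets of vertices (finite or infinite) at
distance at least `2` are independent. -/
def OneDependent {Ω : Type v} [MeasurableSpace Ω]
    (P : Measure Ω) (β : V → Ω → ℝ) : Prop :=
  ∀ U U' : Set V, 2 ≤ setDist G U U' →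
    IndepFun (fun ω (i : U) => β i ω) (fun ω (j : U') => β j ω) P

variable [G.LocallyFinite]

open Classical in
/-- `∑_{i ∼ j, i ∈ U, j ∉ U} W_{i,j} (√(1 + t i) - 1)`. -/
def boundaryEnergy (W : Sym2 V → ℝ) (U : Finset V) (t : V → ℝ) : ℝ :=
  ∑ i ∈ U, ∑ j ∈ G.neighborFinset i with j ∉ U, W s(i, j) * (Real.sqrt (1 + t i) - 1)

/-- `W_i = ∑_{j ∼ i} W_{i,j}`. -/
def vertexWeight (W : Sym2 V → ℝ) (i : V) : ℝ :=
  ∑ j ∈ G.neighborFinset i, W s(i, j)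

/-- `(β i)_{i ∈ V}` is a family of (almost surely) positive random variables on the space `(Ω, P)`
with the prescribed Laplace transforms on the finite sets of vertices. -/
structure IsBetaField (W : Sym2 V → ℝ) {Ω : Type v} [MeasurableSpace Ω] (P : Measure Ω)
    (β : V → Ω → ℝ) : Prop where
  measurable : ∀ i, Measurable (β i)
  pos : ∀ i, ∀ᵐ ω ∂P, 0 < β i ω
  laplace : ∀ (U : Finset V) (t : V → ℝ), (∀ i ∈ U, 0 ≤ t i) →
    ∫ ω, Real.exp (-∑ i ∈ U, t i * β i ω) ∂P =
      Real.exp (-innerEnergy G W U t - boundaryEnergy G W U t) *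
        (1 / ∏ i ∈ U, Real.sqrt (1 + t i))

/-- For every vertex `i` that has a neighbour (so that `W_i > 0`), the variable `1 / (2 β i)` is
inverse Gaussian with parameters `(1 / W_i, 1)`. -/
def InverseGaussianMarginals (W : Sym2 V → ℝ) {Ω : Type v} [MeasurableSpace Ω]
    (P : Measure Ω) (β : V → Ω → ℝ) : Prop :=
  ∀ i, (∃ j, G.Adj i j) →
    HasLaw (fun ω => 1 / (2 * β i ω)) (inverseGaussianMeasure (1 / vertexWeight G W i) 1) P

end

end BetaField

/-! Write s_i = √(1 + λ_i). Everything rests on one integral, `lintegral_hittingKernel`: ∫₀^∞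
(2πx³)^(-1/2) exp(-p²/(2x) - c²x/2) dx = e^(-pc)/p for p > 0, c ≥ 0. On a finite set U the field is
built vertex by vertex together with the Green form Q = (2β - W)⁻¹ on U (`exists_lintegral_exp_eq`).
A new vertex enters through the Schur complement, its free parameter x being the new diagonal entry
of the inverse. Integrating x out completes a square in Q, which shifts the external field and calls
the induction hypothesis. Tilting by the conductances that leave U gives the required transform. For
infinite V these transforms are consistent in U. In the coordinates e^(-β) the finite laws live on a
compact cube, so they have a limit along an ultrafilter, and it keeps the transforms. The one-vertex
marginals show that no mass escapes to β = 0 or β = ∞. Laplace transforms at integer points are the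
mixed moments of e^(-β), so Stone–Weierstrass gives uniqueness (`map_eq_of_integral_exp_eq`). Both
properties then follow by comparing transforms: the energy is additive over sets without edges
between them, and at a single vertex the integral above produces the inverse Gaussian law. -/

/-! ### The hitting-time integral -/

open Filter Topology in
lemma hasDerivAt_integral_gaussian (t : ℝ) :
    HasDerivAt (fun t : ℝ => ∫ r in (0 : ℝ)..t, Real.exp (-(1 / 2) * r ^ 2))
      (Real.exp (-(1 / 2) * t ^ 2)) t := by
  have h : Continuous fun r : ℝ => Real.exp (-(1 / 2) * r ^ 2) := by fun_prop
  exact intervalIntegral.integral_hasDerivAt_right (h.intervalIntegrable _ _)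
    (h.stronglyMeasurableAtFilter _ _) h.continuousAt

open Filter Topology in
lemma tendsto_integral_gaussian_atTop :
    Tendsto (fun t : ℝ => ∫ r in (0 : ℝ)..t, Real.exp (-(1 / 2) * r ^ 2)) atTop
      (𝓝 (Real.sqrt (2 * Real.pi) / 2)) := by
  have h := intervalIntegral_tendsto_integral_Ioi (μ := volume) (0 : ℝ)
    (integrable_exp_neg_mul_sq (b := 1 / 2) (by norm_num)).integrableOn tendsto_id
  rw [integral_gaussian_Ioi] at h
  have e : Real.pi / (1 / 2) = 2 * Real.pi := by ring
  rw [e] at h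
  exact h

open Filter Topology in
lemma tendsto_integral_gaussian_atBot :
    Tendsto (fun t : ℝ => ∫ r in (0 : ℝ)..t, Real.exp (-(1 / 2) * r ^ 2)) atBot
      (𝓝 (-(Real.sqrt (2 * Real.pi) / 2))) := by
  have h := (tendsto_integral_gaussian_atTop.comp tendsto_neg_atBot_atTop).neg
  refine h.congr fun t => ?_
  have h2 := intervalIntegral.integral_comp_neg (a := 0) (b := t)
    (fun r : ℝ => Real.exp (-(1 / 2) * r ^ 2))
  simp only [neg_sq, neg_zero] at h2
  simp only [Function.comp_apply]
  rw [h2, intervalIntegral.integral_symm (-t) 0, neg_neg]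

/-- The density of the first hitting time of the level `p` by Brownian motion with drift, up to
normalisation. -/
noncomputable def hittingKernel (p a x : ℝ) : ℝ :=
  (Real.sqrt (2 * Real.pi * x ^ 3))⁻¹ * Real.exp (-(p ^ 2 / (2 * x)) - a ^ 2 * x / 2)

lemma hittingKernel_nonneg (p a x : ℝ) : 0 ≤ hittingKernel p a x := by
  unfold hittingKernel; positivity

@[fun_prop]
lemma measurable_hittingKernel (p a : ℝ) : Measurable (hittingKernel p a) := by
  unfold hittingKernel; fun_prop

/-- The factors e^(∓pa) cancel the cross terms of (p/√x ∓ a√x)², so both Gaussians become the same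
exponential. The derivatives of ∓a√x then cancel, leaving twice that of p/√x. -/
lemma hasDerivAt_hittingPrimitive {p a x : ℝ} (hp : 0 < p) (hx : 0 < x) :
    HasDerivAt (fun x : ℝ => -(Real.exp (-(p * a)) *
        (∫ r in (0 : ℝ)..(p / √x - a * √x), Real.exp (-(1 / 2) * r ^ 2)) + Real.exp (p * a) *
        (∫ r in (0 : ℝ)..(p / √x + a * √x), Real.exp (-(1 / 2) * r ^ 2))) / (p * √(2 * Real.pi)))
      (hittingKernel p a x) x := by
  have hs : 0 < √x := Real.sqrt_pos.2 hx
  have d1 : HasDerivAt (fun x : ℝ => √x) (1 / (2 * √x)) x := Real.hasDerivAt_sqrt hx.ne'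
  have d2 : HasDerivAt (fun x : ℝ => p / √x) (-(p * (1 / (2 * √x))) / √x ^ 2) x := by
    simpa using (hasDerivAt_const x p).fun_div d1 hs.ne'
  have du := (hasDerivAt_integral_gaussian (p / √x - a * √x)).comp x
    (d2.fun_sub (d1.const_mul a))
  have dv := (hasDerivAt_integral_gaussian (p / √x + a * √x)).comp x
    (d2.fun_add (d1.const_mul a))
  have h := (((du.const_mul (Real.exp (-(p * a)))).fun_add
    (dv.const_mul (Real.exp (p * a)))).fun_neg).div_const (p * √(2 * Real.pi))
  refine h.congr_deriv ?_
  clear h du dv d1 d2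
  obtain ⟨y, hy, hyx⟩ : ∃ y, 0 < y ∧ x = y ^ 2 := ⟨√x, hs, (Real.sq_sqrt hx.le).symm⟩
  subst hyx
  rw [Real.sqrt_sq hy.le]
  have e1 : Real.exp (-(p * a)) * Real.exp (-(1 / 2) * (p / y - a * y) ^ 2) =
      Real.exp (-(p ^ 2 / (2 * y ^ 2)) - a ^ 2 * y ^ 2 / 2) := by
    rw [← Real.exp_add]; congr 1; field_simp; ring
  have e2 : Real.exp (p * a) * Real.exp (-(1 / 2) * (p / y + a * y) ^ 2) =
      Real.exp (-(p ^ 2 / (2 * y ^ 2)) - a ^ 2 * y ^ 2 / 2) := by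
    rw [← Real.exp_add]; congr 1; field_simp; ring
  have hpi : 0 < √(2 * Real.pi) := by positivity
  rw [← mul_assoc, ← mul_assoc, e1, e2, hittingKernel, Real.sqrt_mul (x := 2 * Real.pi) (by positivity),
    show (y ^ 2) ^ 3 = (y ^ 3) ^ 2 by ring, Real.sqrt_sq (by positivity)]
  generalize √(2 * Real.pi) = c at *
  field_simp
  ring

open Filter Topology in
lemma lintegral_hittingKernel {p a : ℝ} (hp : 0 < p) (ha : 0 ≤ a) :
    ∫⁻ x in Set.Ioi (0 : ℝ), ENNReal.ofReal (hittingKernel p a x) =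
      ENNReal.ofReal (Real.exp (-(p * a)) / p) := by
  set F : ℝ → ℝ := fun x : ℝ => -(Real.exp (-(p * a)) *
        (∫ r in (0 : ℝ)..(p / √x - a * √x), Real.exp (-(1 / 2) * r ^ 2)) + Real.exp (p * a) *
        (∫ r in (0 : ℝ)..(p / √x + a * √x), Real.exp (-(1 / 2) * r ^ 2))) / (p * √(2 * Real.pi))
    with hF
  have hpi : 0 < √(2 * Real.pi) := by positivity
  have hsq0 : Tendsto (fun x : ℝ => √x) (𝓝[>] 0) (𝓝 0) := by
    have : Tendsto (fun x : ℝ => √x) (𝓝 0) (𝓝 (√0)) := Real.continuous_sqrt.tendsto 0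
    rw [Real.sqrt_zero] at this
    exact this.mono_left nhdsWithin_le_nhds
  have hinv0 : Tendsto (fun x : ℝ => p / √x) (𝓝[>] 0) atTop := by
    have : Tendsto (fun x : ℝ => √x) (𝓝[>] 0) (𝓝[>] 0) :=
      tendsto_nhdsWithin_iff.2 ⟨hsq0, by
        filter_upwards [self_mem_nhdsWithin] with x hx using Real.sqrt_pos.2 hx⟩
    simpa [div_eq_mul_inv] using (tendsto_inv_nhdsGT_zero.comp this).const_mul_atTop hp
  have hu0 : Tendsto (fun x : ℝ => p / √x - a * √x) (𝓝[>] 0) atTop := by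
    simpa [sub_eq_add_neg] using hinv0.atTop_add ((hsq0.const_mul a).neg)
  have hv0 : Tendsto (fun x : ℝ => p / √x + a * √x) (𝓝[>] 0) atTop :=
    hinv0.atTop_add (hsq0.const_mul a)
  have hF0 : Tendsto F (𝓝[>] 0)
      (𝓝 (-(Real.exp (-(p * a)) + Real.exp (p * a)) / (2 * p))) := by
    have := (((tendsto_integral_gaussian_atTop.comp hu0).const_mul (Real.exp (-(p * a)))).add
      ((tendsto_integral_gaussian_atTop.comp hv0).const_mul (Real.exp (p * a)))).neg.div_const
      (p * √(2 * Real.pi))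
    have e : -(Real.exp (-(p * a)) + Real.exp (p * a)) / (2 * p) =
        -(Real.exp (-(p * a)) * (√(2 * Real.pi) / 2) + Real.exp (p * a) * (√(2 * Real.pi) / 2)) /
          (p * √(2 * Real.pi)) := by
      generalize √(2 * Real.pi) = c at *
      field_simp
    rw [e]
    exact this
  have hinv : Tendsto (fun x : ℝ => p / √x) atTop (𝓝 0) :=
    tendsto_const_nhds.div_atTop Real.tendsto_sqrt_atTop
  have hFtop : Tendsto F atTop
      (𝓝 (-(-Real.exp (-(p * a)) + Real.exp (p * a)) / (2 * p))) := by
    -- For a = 0 both upper limits tend to 0 instead of ∓∞, but the limit of `F` is given by the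
    -- same formula.
    rcases ha.eq_or_lt with rfl | ha
    · have hc : Tendsto (fun t : ℝ => ∫ r in (0 : ℝ)..t, Real.exp (-(1 / 2) * r ^ 2)) (𝓝 0)
          (𝓝 0) := by
        simpa using (hasDerivAt_integral_gaussian 0).continuousAt.tendsto
      have := (((hc.comp hinv).const_mul 1).add ((hc.comp hinv).const_mul 1)).neg.div_const
        (p * √(2 * Real.pi))
      simpa [hF, Function.comp_def] using this
    · have hat : Tendsto (fun x : ℝ => a * √x) atTop atTop :=
        Real.tendsto_sqrt_atTop.const_mul_atTop ha
      have hu : Tendsto (fun x : ℝ => p / √x - a * √x) atTop atBot := by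
        simpa [sub_eq_add_neg] using hinv.add_atBot (tendsto_neg_atTop_atBot.comp hat)
      have hv : Tendsto (fun x : ℝ => p / √x + a * √x) atTop atTop := hinv.add_atTop hat
      have := (((tendsto_integral_gaussian_atBot.comp hu).const_mul (Real.exp (-(p * a)))).add
        ((tendsto_integral_gaussian_atTop.comp hv).const_mul (Real.exp (p * a)))).neg.div_const
        (p * √(2 * Real.pi))
      have e : -(-Real.exp (-(p * a)) + Real.exp (p * a)) / (2 * p) =
          -(Real.exp (-(p * a)) * -(√(2 * Real.pi) / 2) +
            Real.exp (p * a) * (√(2 * Real.pi) / 2)) / (p * √(2 * Real.pi)) := by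
        generalize √(2 * Real.pi) = c at *
        field_simp
      rw [e]
      exact this
  -- Since p / √0 = 0 by convention, `F 0` is 0 and not the right limit at 0; continuity up to the
  -- endpoint requires the corrected value.
  set G : ℝ → ℝ := Function.update F 0 (-(Real.exp (-(p * a)) + Real.exp (p * a)) / (2 * p))
  have hGF : ∀ x, 0 < x → G =ᶠ[𝓝 x] F := fun x hx => by
    filter_upwards [Ioi_mem_nhds hx] with y hy
    exact Function.update_of_ne (ne_of_gt hy) _ _
  have hG0 : ContinuousWithinAt G (Set.Ici 0) 0 := by
    rw [continuousWithinAt_update_same]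
    simpa using hF0
  have hderiv : ∀ x ∈ Set.Ioi (0 : ℝ), HasDerivAt G (hittingKernel p a x) x := fun x hx =>
    (hasDerivAt_hittingPrimitive hp hx).congr_of_eventuallyEq (hGF x hx)
  have hGtop : Tendsto G atTop (𝓝 (-(-Real.exp (-(p * a)) + Real.exp (p * a)) / (2 * p))) := by
    refine hFtop.congr' ?_
    filter_upwards [eventually_gt_atTop 0] with y hy
    exact (Function.update_of_ne (ne_of_gt hy) _ _).symm
  have hpos : ∀ x ∈ Set.Ioi (0 : ℝ), 0 ≤ hittingKernel p a x := fun x _ => hittingKernel_nonneg _ _ _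
  have hint := integrableOn_Ioi_deriv_of_nonneg hG0 hderiv hpos hGtop
  have hval := integral_Ioi_of_hasDerivAt_of_nonneg hG0 hderiv hpos hGtop
  rw [← ofReal_integral_eq_lintegral_ofReal hint (ae_of_all _ fun x => hittingKernel_nonneg _ _ _),
    hval]
  congr 1
  simp only [G, Function.update_self]
  field_simp
  ring

/-! ### Uniqueness of a law with given Laplace transforms -/

open BoundedContinuousFunction in
/-- A finite measure on a countable power of the unit interval is determined by its mixed
moments. -/
lemma ext_of_integral_prod_pow {ι : Type*} [Countable ι] {μ ν : Measure (ι → unitInterval)}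
    [IsFiniteMeasure μ] [IsFiniteMeasure ν]
    (h : ∀ n : ι →₀ ℕ, ∫ y, n.prod (fun i k => (y i : ℝ) ^ k) ∂μ =
      ∫ y, n.prod (fun i k => (y i : ℝ) ^ k) ∂ν) : μ = ν := by
  let coord : ι → ((ι → unitInterval) →ᵇ ℝ) := fun i =>
    BoundedContinuousFunction.mkOfCompact ⟨fun y => (y i : ℝ), by fun_prop⟩
  -- Polynomials in the coordinates form an algebra that separates points. It is spanned by
  -- monomials, so equality of moments suffices.
  let A : StarSubalgebra ℝ ((ι → unitInterval) →ᵇ ℝ) :=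
    { Algebra.adjoin ℝ (Set.range coord) with
      star_mem' := fun {g} hg => by
        have : star g = g := by ext y; simp
        rw [this]; exact hg }
  refine ext_of_forall_mem_subalgebra_integral_eq_of_polish (𝕜 := ℝ) (A := A) ?_ ?_
  · intro x y hxy
    obtain ⟨i, hi⟩ := Function.ne_iff.1 hxy
    refine ⟨_, ⟨toContinuousMapStarₐ ℝ (coord i), ⟨coord i, ?_, rfl⟩, rfl⟩, ?_⟩
    · exact Algebra.subset_adjoin ⟨i, rfl⟩
    · exact fun h => hi (Subtype.ext h)
  · intro g hg
    replace hg : g ∈ Subalgebra.toSubmodule (Algebra.adjoin ℝ (Set.range coord)) := hg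
    rw [Algebra.adjoin_eq_span] at hg
    induction hg using Submodule.span_induction with
    | mem g hg =>
      obtain ⟨n, hn⟩ : ∃ n : ι →₀ ℕ, ∀ y, g y = n.prod (fun i k => (y i : ℝ) ^ k) := by
        induction hg using Submonoid.closure_induction with
        | mem g hg =>
          obtain ⟨i, rfl⟩ := hg
          exact ⟨Finsupp.single i 1, fun y => by simp [coord]⟩
        | one => exact ⟨0, fun y => by simp⟩
        | mul f g _ _ hf hg =>
          obtain ⟨m, hm⟩ := hf
          obtain ⟨n, hn⟩ := hg
          refine ⟨m + n, fun y => ?_⟩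
          classical
          rw [Finsupp.prod_add_index' (by simp) (fun _ _ _ => pow_add _ _ _), ← hm, ← hn]
          rfl
      simp_rw [hn]
      exact h n
    | zero => simp
    | add f g hf hg hf' hg' =>
      simp only [BoundedContinuousFunction.coe_add, Pi.add_apply]
      rw [integral_add (f.integrable _) (g.integrable _),
        integral_add (f.integrable _) (g.integrable _), hf', hg']
    | smul c f hf hf' =>
      simp only [BoundedContinuousFunction.coe_smul, smul_eq_mul]
      rw [integral_const_mul, integral_const_mul, hf']

/-- The map `x ↦ exp (-x)` from `[0, ∞)` to the unit interval, extended by `1` to negative `x`. -/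
noncomputable def expNeg (x : ℝ) : unitInterval :=
  ⟨Real.exp (-max x 0), (Real.exp_pos _).le, Real.exp_le_one_iff.2 (by simp)⟩

lemma coe_expNeg {x : ℝ} (hx : 0 ≤ x) : (expNeg x : ℝ) = Real.exp (-x) := by
  simp [expNeg, hx]

@[fun_prop]
lemma measurable_expNeg : Measurable expNeg :=
  Measurable.subtype_mk (by fun_prop)

/-- Mixed moments of e^(-β) are values of the Laplace transform at integer points. -/
lemma prod_expNeg_pow_ae_eq {ι Ω : Type*} [Countable ι] [MeasurableSpace Ω] {P : Measure Ω}
    {β : ι → Ω → ℝ} (pos : ∀ i, ∀ᵐ ω ∂P, 0 ≤ β i ω) (n : ι →₀ ℕ) :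
    ∀ᵐ ω ∂P, n.prod (fun i k => (expNeg (β i ω) : ℝ) ^ k) =
      Real.exp (-∑ i ∈ n.support, (n i : ℝ) * β i ω) := by
  filter_upwards [ae_all_iff.2 pos] with ω hω
  rw [← Finset.sum_neg_distrib, Real.exp_sum, Finsupp.prod]
  refine Finset.prod_congr rfl fun i _ => ?_
  rw [coe_expNeg (hω i), ← Real.exp_nat_mul]
  ring_nf

lemma map_eq_map_neg_log_map_expNeg {ι Ω : Type*} [Countable ι] [MeasurableSpace Ω]
    {P : Measure Ω} {β : ι → Ω → ℝ} (hβ : ∀ i, Measurable (β i))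
    (pos : ∀ i, ∀ᵐ ω ∂P, 0 ≤ β i ω) :
    P.map (fun ω i => β i ω) = (P.map (fun ω i => expNeg (β i ω))).map
      (fun (y : ι → unitInterval) i => -Real.log (y i)) := by
  rw [Measure.map_map (by fun_prop) (by fun_prop)]
  refine Measure.map_congr ?_
  filter_upwards [ae_all_iff.2 pos] with ω hω
  funext i
  simp [coe_expNeg (hω i)]

lemma map_expNeg_eq_of_integral_exp_eq {ι Ω Ω' : Type*} [Countable ι] [MeasurableSpace Ω]
    [MeasurableSpace Ω'] {P : Measure Ω} {P' : Measure Ω'} [IsProbabilityMeasure P]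
    [IsProbabilityMeasure P'] {β : ι → Ω → ℝ} {β' : ι → Ω' → ℝ} (hβ : ∀ i, Measurable (β i))
    (hβ' : ∀ i, Measurable (β' i)) (pos : ∀ i, ∀ᵐ ω ∂P, 0 ≤ β i ω)
    (pos' : ∀ i, ∀ᵐ ω ∂P', 0 ≤ β' i ω)
    (h : ∀ (s : Finset ι) (t : ι → ℝ), (∀ i, 0 ≤ t i) →
      ∫ ω, Real.exp (-∑ i ∈ s, t i * β i ω) ∂P = ∫ ω, Real.exp (-∑ i ∈ s, t i * β' i ω) ∂P') :
    P.map (fun ω i => expNeg (β i ω)) = P'.map (fun ω i => expNeg (β' i ω)) := by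
  have hm : Measurable fun ω i => expNeg (β i ω) := by fun_prop
  have hm' : Measurable fun ω i => expNeg (β' i ω) := by fun_prop
  have := Measure.isProbabilityMeasure_map (μ := P) hm.aemeasurable
  have := Measure.isProbabilityMeasure_map (μ := P') hm'.aemeasurable
  refine ext_of_integral_prod_pow fun n => ?_
  have hc : Measurable fun y : ι → unitInterval => n.prod (fun i k => (y i : ℝ) ^ k) := by
    unfold Finsupp.prod; fun_prop
  rw [integral_map hm.aemeasurable hc.aestronglyMeasurable,
    integral_map hm'.aemeasurable hc.aestronglyMeasurable]
  rw [integral_congr_ae (prod_expNeg_pow_ae_eq pos n), integral_congr_ae (prod_expNeg_pow_ae_eq pos' n)]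
  exact h _ _ fun i => Nat.cast_nonneg _

/-- Almost surely nonnegative families of random variables with the same Laplace transforms on
finite sets of indices have the same law. -/
theorem map_eq_of_integral_exp_eq {ι Ω Ω' : Type*} [Countable ι] [MeasurableSpace Ω]
    [MeasurableSpace Ω'] {P : Measure Ω} {P' : Measure Ω'} [IsProbabilityMeasure P]
    [IsProbabilityMeasure P'] {β : ι → Ω → ℝ} {β' : ι → Ω' → ℝ} (hβ : ∀ i, Measurable (β i))
    (hβ' : ∀ i, Measurable (β' i)) (pos : ∀ i, ∀ᵐ ω ∂P, 0 ≤ β i ω)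
    (pos' : ∀ i, ∀ᵐ ω ∂P', 0 ≤ β' i ω)
    (h : ∀ (s : Finset ι) (t : ι → ℝ), (∀ i, 0 ≤ t i) →
      ∫ ω, Real.exp (-∑ i ∈ s, t i * β i ω) ∂P = ∫ ω, Real.exp (-∑ i ∈ s, t i * β' i ω) ∂P') :
    P.map (fun ω i => β i ω) = P'.map (fun ω i => β' i ω) := by
  rw [map_eq_map_neg_log_map_expNeg hβ pos, map_eq_map_neg_log_map_expNeg hβ' pos',
    map_expNeg_eq_of_integral_exp_eq hβ hβ' pos pos' h]

/-! ### Algebra of the energy -/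

namespace BetaField

section Energy

variable {V : Type u} (G : SimpleGraph V) (W : Sym2 V → ℝ)

open Classical in
/-- The weight of the pair `{i, j}`, which is `0` unless `i` and `j` are adjacent. -/
noncomputable def pairWeight (i j : V) : ℝ := if G.Adj i j then W s(i, j) else 0

variable {G W}

lemma pairWeight_comm (i j : V) : pairWeight G W i j = pairWeight G W j i := by
  classical
  rw [pairWeight, pairWeight, Sym2.eq_swap]
  exact if_congr (G.adj_comm i j) rfl rfl

lemma pairWeight_self (i : V) : pairWeight G W i i = 0 := by simp [pairWeight]

lemma pairWeight_of_adj {i j : V} (h : G.Adj i j) : pairWeight G W i j = W s(i, j) := by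
  simp [pairWeight, h]

lemma pairWeight_of_not_adj {i j : V} (h : ¬ G.Adj i j) : pairWeight G W i j = 0 := by
  simp [pairWeight, h]

lemma pairWeight_nonneg (hW : ∀ e ∈ G.edgeSet, 0 < W e) (i j : V) : 0 ≤ pairWeight G W i j := by
  unfold pairWeight
  split_ifs with h
  · exact (hW _ h).le
  · exact le_rfl

lemma pairSqrt_mk (t : V → ℝ) (i j : V) :
    pairSqrt t s(i, j) = √((1 + t i) * (1 + t j)) := rfl

open Classical in
lemma innerEnergy_insert {U : Finset V} {k : V} (hk : k ∉ U) (t : V → ℝ) :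
    innerEnergy G W (insert k U) t = innerEnergy G W U t +
      ∑ j ∈ U, pairWeight G W k j * (√((1 + t k) * (1 + t j)) - 1) := by
  unfold innerEnergy
  rw [Finset.sum_filter, Finset.sum_filter, Finset.sym2_insert, Finset.sum_union, Finset.sum_image,
    Finset.sum_insert hk, add_comm]
  · congr 1
    rw [if_neg (by simp), zero_add]
    refine Finset.sum_congr rfl fun j _ => ?_
    by_cases h : G.Adj k j
    · simp [h, pairWeight_of_adj h, pairSqrt_mk]
    · simp [h, pairWeight_of_not_adj h]
  · intro a _ b _ hab
    exact Sym2.congr_right.1 hab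
  · rw [Finset.disjoint_left]
    intro e he he'
    obtain ⟨j, _, rfl⟩ := Finset.mem_image.1 he
    exact hk (Finset.mk_mem_sym2_iff.1 he').1

lemma innerEnergy_empty (t : V → ℝ) : innerEnergy G W ∅ t = 0 := by simp [innerEnergy]

-- Passing to ordered pairs counts each edge twice, whence the factor 1/2; the diagonal has weight
-- zero.
open Classical in
lemma innerEnergy_eq_sum_sum (U : Finset V) {t : V → ℝ} (ht : ∀ i ∈ U, 0 ≤ t i) :
    innerEnergy G W U t = 1 / 2 * ∑ i ∈ U, ∑ j ∈ U,
      pairWeight G W i j * (√(1 + t i) * √(1 + t j) - 1) := by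
  induction U using Finset.induction_on with
  | empty => simp [innerEnergy_empty]
  | insert k U hk ih =>
    rw [innerEnergy_insert hk, ih fun i hi => ht i (Finset.mem_insert_of_mem hi),
      Finset.sum_insert hk, Finset.sum_insert hk, pairWeight_self]
    have e : ∀ i ∈ U, ∑ j ∈ insert k U, pairWeight G W i j * (√(1 + t i) * √(1 + t j) - 1) =
        pairWeight G W k i * (√(1 + t k) * √(1 + t i) - 1) +
        ∑ j ∈ U, pairWeight G W i j * (√(1 + t i) * √(1 + t j) - 1) := fun i _ => by
      rw [Finset.sum_insert hk, pairWeight_comm i k, mul_comm √(1 + t i)]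
    have hs : ∀ j ∈ U, pairWeight G W k j * (√((1 + t k) * (1 + t j)) - 1) =
        pairWeight G W k j * (√(1 + t k) * √(1 + t j) - 1) := fun j _ => by
      rw [Real.sqrt_mul (by linarith [ht k (Finset.mem_insert_self _ _)])]
    rw [Finset.sum_congr rfl e, Finset.sum_congr rfl hs, Finset.sum_add_distrib]
    ring

variable [G.LocallyFinite]

variable (G W) in
open Classical in
/-- The total conductance between the vertex `i` and the complement of `U`. -/
noncomputable def outerWeight (U : Finset V) (i : V) : ℝ :=
  ∑ j ∈ G.neighborFinset i with j ∉ U, W s(i, j)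

lemma outerWeight_nonneg (hW : ∀ e ∈ G.edgeSet, 0 < W e) (U : Finset V) (i : V) :
    0 ≤ outerWeight G W U i := by
  classical
  exact Finset.sum_nonneg fun j hj => (hW _ (by simpa using (Finset.mem_filter.1 hj).1)).le

lemma outerWeight_eq (U : Finset V) (i : V) :
    outerWeight G W U i = vertexWeight G W i - ∑ j ∈ U, pairWeight G W i j := by
  classical
  have h1 : ∑ j ∈ U, pairWeight G W i j =
      ∑ j ∈ G.neighborFinset i with j ∈ U, W s(i, j) := by
    have : (G.neighborFinset i).filter (· ∈ U) = U.filter (G.Adj i) := by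
      ext j; simp [and_comm]
    rw [this, Finset.sum_filter]
    rfl
  rw [h1, outerWeight, vertexWeight, eq_sub_iff_add_eq, add_comm]
  convert Finset.sum_filter_add_sum_filter_not (G.neighborFinset i) (· ∈ U) (fun j => W s(i, j))

lemma boundaryEnergy_eq_sum (U : Finset V) (t : V → ℝ) :
    boundaryEnergy G W U t = ∑ i ∈ U, outerWeight G W U i * (√(1 + t i) - 1) := by
  simp_rw [boundaryEnergy, outerWeight, Finset.sum_mul]

variable (G W) in
/-- The energy in the Laplace transform of the field on the finite set `U`. -/
noncomputable def totalEnergy (U : Finset V) (t : V → ℝ) : ℝ :=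
  innerEnergy G W U t + boundaryEnergy G W U t

lemma totalEnergy_empty (t : V → ℝ) : totalEnergy G W ∅ t = 0 := by
  simp [totalEnergy, innerEnergy_empty, boundaryEnergy]

-- An edge from k to j ∈ U stops being a boundary edge at j and becomes an inner edge. For
-- nonnegative t each summand is w_kj (s_k - 1)(s_j - 1) with s = √(1 + t). Consistency and
-- additivity both come from this form.
open Classical in
lemma totalEnergy_insert {U : Finset V} {k : V} (hk : k ∉ U) (t : V → ℝ) :
    totalEnergy G W (insert k U) t = totalEnergy G W U t +
      (vertexWeight G W k * (√(1 + t k) - 1) + ∑ j ∈ U, pairWeight G W k j *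
        (√((1 + t k) * (1 + t j)) - √(1 + t k) - √(1 + t j) + 1)) := by
  rw [totalEnergy, totalEnergy, innerEnergy_insert hk, boundaryEnergy_eq_sum,
    boundaryEnergy_eq_sum, Finset.sum_insert hk]
  have e : ∀ i ∈ U, outerWeight G W (insert k U) i * (√(1 + t i) - 1) =
      outerWeight G W U i * (√(1 + t i) - 1) - pairWeight G W k i * (√(1 + t i) - 1) :=
    fun i _ => by
      rw [outerWeight_eq, outerWeight_eq, Finset.sum_insert hk, pairWeight_comm i k]; ring
  have e2 : ∑ j ∈ U, pairWeight G W k j *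
        (√((1 + t k) * (1 + t j)) - √(1 + t k) - √(1 + t j) + 1) =
      ∑ j ∈ U, pairWeight G W k j * (√((1 + t k) * (1 + t j)) - 1) -
      (∑ j ∈ U, pairWeight G W k j) * (√(1 + t k) - 1) -
      ∑ j ∈ U, pairWeight G W k j * (√(1 + t j) - 1) := by
    rw [Finset.sum_mul, ← Finset.sum_sub_distrib, ← Finset.sum_sub_distrib]
    exact Finset.sum_congr rfl fun j _ => by ring
  rw [Finset.sum_congr rfl e, Finset.sum_sub_distrib, outerWeight_eq, Finset.sum_insert hk,
    pairWeight_self, e2]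
  ring

lemma totalEnergy_congr {U : Finset V} {t t' : V → ℝ} (h : ∀ i ∈ U, t i = t' i) :
    totalEnergy G W U t = totalEnergy G W U t' := by
  classical
  induction U using Finset.induction_on with
  | empty => simp [totalEnergy_empty]
  | insert k U hk ih =>
    have h' : ∀ i ∈ U, t i = t' i := fun i hi => h i (Finset.mem_insert_of_mem hi)
    rw [totalEnergy_insert hk, totalEnergy_insert hk, ih h', h k (Finset.mem_insert_self _ _)]
    congr 2
    exact Finset.sum_congr rfl fun j hj => by rw [h' j hj]

lemma totalEnergy_singleton (i : V) (t : V → ℝ) :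
    totalEnergy G W {i} t = vertexWeight G W i * (√(1 + t i) - 1) := by
  classical
  simpa [totalEnergy_empty] using
    totalEnergy_insert (G := G) (W := W) (Finset.notMem_empty i) t

-- A vertex with t = 0 adds no energy, which is the consistency of the transforms in U.
open Classical in
lemma totalEnergy_union_of_eq_zero {U U' : Finset V} {t : V → ℝ} (h : ∀ i ∈ U', i ∉ U → t i = 0) :
    totalEnergy G W (U ∪ U') t = totalEnergy G W U t := by
  induction U' using Finset.induction_on with
  | empty => simp
  | insert k U' hk ih =>
    have ih' := ih fun i hi => h i (Finset.mem_insert_of_mem hi)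
    rw [Finset.union_insert]
    by_cases hkU : k ∈ U ∪ U'
    · rwa [Finset.insert_eq_of_mem hkU]
    · have hk0 : t k = 0 := h k (Finset.mem_insert_self _ _)
        fun hm => hkU (Finset.mem_union_left _ hm)
      rw [totalEnergy_insert hkU, ih', hk0]
      simp

-- All interaction terms between the two sets have weight zero. This is the source of 1-dependence.
open Classical in
lemma totalEnergy_union_of_not_adj {U U' : Finset V} (t : V → ℝ) (hd : Disjoint U U')
    (h : ∀ i ∈ U, ∀ j ∈ U', ¬ G.Adj i j) :
    totalEnergy G W (U ∪ U') t = totalEnergy G W U t + totalEnergy G W U' t := by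
  induction U' using Finset.induction_on with
  | empty => simp [totalEnergy_empty]
  | insert k U' hk ih =>
    rw [Finset.disjoint_insert_right] at hd
    have ih' := ih hd.2 fun i hi j hj => h i hi j (Finset.mem_insert_of_mem hj)
    have hkU : k ∉ U ∪ U' := by simp [hd.1, hk]
    rw [Finset.union_insert, totalEnergy_insert hkU, totalEnergy_insert hk, ih',
      Finset.sum_union hd.2, Finset.sum_eq_zero (s := U)]
    · ring
    · intro j hj
      rw [pairWeight_of_not_adj fun hkj => h j hj k (Finset.mem_insert_self _ _) hkj.symm, zero_mul]

variable (G W) in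
/-- The Laplace transform of the field on the finite set `U`. -/
noncomputable def laplaceValue (U : Finset V) (t : V → ℝ) : ℝ :=
  Real.exp (-totalEnergy G W U t) * (1 / ∏ i ∈ U, √(1 + t i))

lemma laplaceValue_eq (U : Finset V) (t : V → ℝ) :
    laplaceValue G W U t = Real.exp (-innerEnergy G W U t - boundaryEnergy G W U t) *
      (1 / ∏ i ∈ U, √(1 + t i)) := by
  rw [laplaceValue, totalEnergy, neg_add, sub_eq_add_neg]

lemma laplaceValue_congr {U : Finset V} {t t' : V → ℝ} (h : ∀ i ∈ U, t i = t' i) :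
    laplaceValue G W U t = laplaceValue G W U t' := by
  rw [laplaceValue, laplaceValue, totalEnergy_congr h, Finset.prod_congr rfl fun i hi => by
    rw [h i hi]]

lemma laplaceValue_singleton (i : V) (t : V → ℝ) :
    laplaceValue G W {i} t =
      Real.exp (-(vertexWeight G W i * (√(1 + t i) - 1))) / √(1 + t i) := by
  simp [laplaceValue, totalEnergy_singleton, div_eq_mul_inv]

open Classical in
lemma laplaceValue_eq_of_subset {U U' : Finset V} {t : V → ℝ} (hU : U ⊆ U')
    (h : ∀ i ∈ U', i ∉ U → t i = 0) : laplaceValue G W U' t = laplaceValue G W U t := by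
  rw [laplaceValue, laplaceValue, ← totalEnergy_union_of_eq_zero h, Finset.union_eq_right.2 hU]
  congr 2
  exact (Finset.prod_subset hU fun i hi hi' => by simp [h i hi hi']).symm

open Classical in
lemma laplaceValue_union_of_not_adj {U U' : Finset V} (t : V → ℝ) (hd : Disjoint U U')
    (h : ∀ i ∈ U, ∀ j ∈ U', ¬ G.Adj i j) :
    laplaceValue G W (U ∪ U') t = laplaceValue G W U t * laplaceValue G W U' t := by
  rw [laplaceValue, laplaceValue, laplaceValue, totalEnergy_union_of_not_adj t hd h,
    Finset.prod_union hd, neg_add, Real.exp_add, one_div, one_div, one_div, mul_inv]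
  ring

end Energy

end BetaField

/-! ### The field on a finite set of vertices -/

namespace BetaField

/-- The measure `dx / √(2 π x³)` on the positive half-line. -/
noncomputable def hittingMeasure : Measure ℝ :=
  (volume.restrict (Set.Ioi 0)).withDensity
    fun x => ENNReal.ofReal (√(2 * Real.pi * x ^ 3))⁻¹

instance : SFinite hittingMeasure := by unfold hittingMeasure; infer_instance

/-- The measure only sees x > 0; writing |x| keeps the field built from x nonnegative at every
point, not merely almost everywhere. -/
lemma lintegral_hittingMeasure {p c : ℝ} (hp : 0 < p) (hc : 0 ≤ c) (A : ℝ) :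
    ∫⁻ x, ENNReal.ofReal (Real.exp (A - p ^ 2 / (2 * |x|) - c ^ 2 * |x| / 2)) ∂hittingMeasure =
      ENNReal.ofReal (Real.exp (A - p * c) / p) := by
  rw [hittingMeasure, lintegral_withDensity_eq_lintegral_mul _ (by fun_prop) (by fun_prop)]
  have e : ∀ x ∈ Set.Ioi (0 : ℝ), ((fun x => ENNReal.ofReal (√(2 * Real.pi * x ^ 3))⁻¹) *
      fun x => ENNReal.ofReal (Real.exp (A - p ^ 2 / (2 * |x|) - c ^ 2 * |x| / 2))) x =
      ENNReal.ofReal (Real.exp A) * ENNReal.ofReal (hittingKernel p c x) := fun x hx => by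
    rw [Pi.mul_apply, ← ENNReal.ofReal_mul (by positivity), ← ENNReal.ofReal_mul (by positivity),
      hittingKernel, abs_of_pos hx]
    congr 1
    rw [mul_left_comm, ← Real.exp_add]
    ring_nf
  rw [setLIntegral_congr_fun measurableSet_Ioi e, lintegral_const_mul _ (by fun_prop),
    lintegral_hittingKernel hp hc, ← ENNReal.ofReal_mul (by positivity), ← mul_div_assoc,
    ← Real.exp_add, ← sub_eq_add_neg]

/-- The random quadratic form behind the field on a finite set `U` of vertices: it is the inverse
of the random Schrödinger operator, built one vertex at a time. -/
lemma exists_lintegral_exp_eq {V : Type u} {w : V → V → ℝ} (symm : ∀ i j, w i j = w j i)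
    (diag : ∀ i, w i i = 0) (nonneg : ∀ i j, 0 ≤ w i j) (U : Finset V) :
    ∃ (Ω : Type) (_ : MeasurableSpace Ω) (μ : Measure Ω) (β : V → Ω → ℝ)
      (Q : Ω → LinearMap.BilinForm ℝ (V → ℝ)), SFinite μ ∧ (∀ i, Measurable (β i)) ∧
      (∀ i ω, 0 ≤ β i ω) ∧ (∀ x y, Measurable fun ω => Q ω x y) ∧
      (∀ ω x y, 0 ≤ x → 0 ≤ y → 0 ≤ Q ω x y) ∧ (∀ ω x y, Q ω x y = Q ω y x) ∧
      ∀ s h : V → ℝ, (∀ i, 0 < s i) → 0 ≤ h →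
        ∫⁻ ω, ENNReal.ofReal (Real.exp (-∑ i ∈ U, s i ^ 2 * β i ω - 1 / 2 * Q ω h h)) ∂μ =
          ENNReal.ofReal (Real.exp (-(1 / 2 * ∑ i ∈ U, ∑ j ∈ U, w i j * (s i * s j)) -
            ∑ i ∈ U, h i * s i) / ∏ i ∈ U, s i) := by
  classical
  induction U using Finset.induction_on with
  | empty =>
    exact ⟨Unit, inferInstance, Measure.dirac (), fun _ _ => 0, fun _ => 0, inferInstance,
      by fun_prop, by simp, by fun_prop, by simp, by simp, by simp⟩
  | insert k U hk ih =>
    obtain ⟨Ω, _, μ, β, Q, _, hβ, β_nonneg, hQ, Q_nonneg, Q_symm, key⟩ := ih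
    -- Block inversion of 2β - w: with Schur complement 1/x = 2β_k - Q(w_k, w_k), the inverse on U ∪
    -- {k} is Q + x ℓ ⊗ ℓ. This dictates both the new β_k and the new form below.
    let ℓ : Ω → (V → ℝ) →ₗ[ℝ] ℝ := fun ω => LinearMap.proj k + Q ω (w k)
    have hℓ : ∀ ω x, ℓ ω x = x k + Q ω (w k) x := fun ω x => rfl
    have wk : 0 ≤ w k := nonneg k
    have ℓ_nonneg : ∀ ω x, 0 ≤ x → 0 ≤ ℓ ω x := fun ω x hx =>
      add_nonneg (hx k) (Q_nonneg ω _ _ wk hx)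
    have hℓm : ∀ x, Measurable fun z : Ω × ℝ => ℓ z.1 x := fun x => by
      simp only [hℓ]
      exact ((hQ (w k) x).const_add _).comp measurable_fst
    have hQm : ∀ x y, Measurable fun z : Ω × ℝ => Q z.1 x y := fun x y =>
      (hQ x y).comp measurable_fst
    clear_value ℓ
    refine ⟨Ω × ℝ, inferInstance, μ.prod hittingMeasure,
      Function.update (fun i z => β i z.1) k
        (fun z => 1 / (2 * |z.2|) + 1 / 2 * Q z.1 (w k) (w k)),
      fun z => Q z.1 + |z.2| • LinearMap.BilinForm.linMulLin (ℓ z.1) (ℓ z.1),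
      inferInstance, ?_, ?_, ?_, ?_, ?_, ?_⟩
    · intro i
      rcases eq_or_ne i k with rfl | hi
      · rw [Function.update_self]
        have := hQm (w i) (w i)
        fun_prop
      · rw [Function.update_of_ne hi]
        exact (hβ i).comp measurable_fst
    · intro i z
      rcases eq_or_ne i k with rfl | hi
      · rw [Function.update_self]
        have := Q_nonneg z.1 _ _ wk wk
        positivity
      · rw [Function.update_of_ne hi]
        exact β_nonneg i _
    · intro x y
      simp only [LinearMap.add_apply, LinearMap.smul_apply, LinearMap.BilinForm.linMulLin_apply,
        smul_eq_mul]
      have h1 := hQm x y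
      have h2 := hℓm x
      have h3 := hℓm y
      exact h1.add ((by fun_prop : Measurable fun z : Ω × ℝ => |z.2|).mul (h2.mul h3))
    · intro z x y hx hy
      have h1 := Q_nonneg z.1 x y hx hy
      have h2 := ℓ_nonneg z.1 x hx
      have h3 := ℓ_nonneg z.1 y hy
      simp only [LinearMap.add_apply, LinearMap.smul_apply, LinearMap.BilinForm.linMulLin_apply,
        smul_eq_mul]
      positivity
    · intro z x y
      simp only [LinearMap.add_apply, LinearMap.smul_apply, LinearMap.BilinForm.linMulLin_apply,
        smul_eq_mul, Q_symm z.1 x y]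
      ring
    · intro s h hs hh
      have hexp : ∀ (ω : Ω) (x : ℝ),
          -∑ i ∈ insert k U, s i ^ 2 * Function.update (fun i (z : Ω × ℝ) => β i z.1) k
            (fun z => 1 / (2 * |z.2|) + 1 / 2 * Q z.1 (w k) (w k)) i (ω, x) -
            1 / 2 * (Q ω + |x| • LinearMap.BilinForm.linMulLin (ℓ ω) (ℓ ω)) h h =
          (-∑ i ∈ U, s i ^ 2 * β i ω - 1 / 2 * s k ^ 2 * Q ω (w k) (w k) - 1 / 2 * Q ω h h) -
            s k ^ 2 / (2 * |x|) - (ℓ ω h) ^ 2 * |x| / 2 := fun ω x => by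
        have e : ∀ i ∈ U, s i ^ 2 * Function.update (fun i (z : Ω × ℝ) => β i z.1) k
            (fun z => 1 / (2 * |z.2|) + 1 / 2 * Q z.1 (w k) (w k)) i (ω, x) =
            s i ^ 2 * β i ω := fun i hi => by
          rw [Function.update_of_ne (ne_of_mem_of_not_mem hi hk)]
        rw [Finset.sum_insert hk, Finset.sum_congr rfl e, Function.update_self]
        simp only [LinearMap.add_apply, LinearMap.smul_apply,
          LinearMap.BilinForm.linMulLin_apply, smul_eq_mul]
        ring
      -- The shifted field is again nonnegative, so the induction hypothesis applies to it; this is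
      -- why the statement quantifies over all h ≥ 0.
      have hs' : 0 ≤ h + s k • w k := add_nonneg hh (smul_nonneg (hs k).le wk)
      rw [lintegral_prod]
      · simp only [hexp]
        -- Integrating x with p = s_k and c = ℓ(h) produces -s_k ℓ(h), exactly the cross term that
        -- completes the square to Q(h + s_k w_k, h + s_k w_k).
        have e2 : ∀ ω, (-∑ i ∈ U, s i ^ 2 * β i ω - 1 / 2 * s k ^ 2 * Q ω (w k) (w k) -
              1 / 2 * Q ω h h) - s k * ℓ ω h =
            (-∑ i ∈ U, s i ^ 2 * β i ω - 1 / 2 * Q ω (h + s k • w k) (h + s k • w k)) -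
              s k * h k := fun ω => by
          simp only [hℓ, map_add, map_smul, LinearMap.add_apply, LinearMap.smul_apply,
            smul_eq_mul, Q_symm ω h (w k)]
          ring
        have e3 : ∀ ω, ENNReal.ofReal (Real.exp ((-∑ i ∈ U, s i ^ 2 * β i ω -
              1 / 2 * Q ω (h + s k • w k) (h + s k • w k)) - s k * h k) / s k) =
            ENNReal.ofReal (Real.exp (-(s k * h k)) / s k) *
            ENNReal.ofReal (Real.exp (-∑ i ∈ U, s i ^ 2 * β i ω -
              1 / 2 * Q ω (h + s k • w k) (h + s k • w k))) := fun ω => by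
          have := hs k
          rw [← ENNReal.ofReal_mul (by positivity), sub_eq_add_neg _ (s k * h k), Real.exp_add]
          congr 1
          ring
        simp only [lintegral_hittingMeasure (hs k) (ℓ_nonneg _ h hh), e2, e3]
        have hmeas : Measurable fun ω => ENNReal.ofReal (Real.exp (-∑ i ∈ U, s i ^ 2 * β i ω -
              1 / 2 * Q ω (h + s k • w k) (h + s k • w k))) := by
          have := hQ (h + s k • w k) (h + s k • w k)
          fun_prop
        have hpos : 0 < s k := hs k
        rw [lintegral_const_mul _ hmeas, key s _ hs hs', ← ENNReal.ofReal_mul (by positivity),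
          Finset.prod_insert hk, Finset.sum_insert hk, Finset.sum_insert hk, Finset.sum_insert hk,
          diag, div_mul_div_comm, ← Real.exp_add]
        have e4 : ∑ i ∈ U, ∑ j ∈ insert k U, w i j * (s i * s j) =
            ∑ i ∈ U, w k i * (s k * s i) + ∑ i ∈ U, ∑ j ∈ U, w i j * (s i * s j) := by
          rw [← Finset.sum_add_distrib]
          refine Finset.sum_congr rfl fun i _ => ?_
          rw [Finset.sum_insert hk, symm i k, mul_comm (s i)]
        have e5 : ∑ i ∈ U, (h + s k • w k) i * s i =
            ∑ i ∈ U, h i * s i + ∑ i ∈ U, w k i * (s k * s i) := by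
          rw [← Finset.sum_add_distrib]
          refine Finset.sum_congr rfl fun i _ => ?_
          simp only [Pi.add_apply, Pi.smul_apply, smul_eq_mul]
          ring
        rw [e4, e5]
        congr 3
        ring
      · refine Measurable.aemeasurable ?_
        refine ENNReal.measurable_ofReal.comp (Real.measurable_exp.comp ?_)
        have : (fun z : Ω × ℝ => -∑ i ∈ insert k U, s i ^ 2 * Function.update
            (fun i (z : Ω × ℝ) => β i z.1) k
            (fun z => 1 / (2 * |z.2|) + 1 / 2 * Q z.1 (w k) (w k)) i z -
            1 / 2 * (Q z.1 + |z.2| • LinearMap.BilinForm.linMulLin (ℓ z.1) (ℓ z.1)) h h) =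
            fun z => (-∑ i ∈ U, s i ^ 2 * β i z.1 - 1 / 2 * s k ^ 2 * Q z.1 (w k) (w k) -
              1 / 2 * Q z.1 h h) - s k ^ 2 / (2 * |z.2|) - (ℓ z.1 h) ^ 2 * |z.2| / 2 :=
          funext fun z => hexp z.1 z.2
        rw [this]
        have h1 := hQm (w k) (w k)
        have h2 := hQm h h
        have h3 := hℓm h
        have h4 : ∀ i, Measurable fun z : Ω × ℝ => β i z.1 := fun i => (hβ i).comp measurable_fst
        exact (((((Finset.measurable_fun_sum U fun i _ => (h4 i).const_mul _).neg.sub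
          (h1.const_mul _)).sub (h2.const_mul _)).sub
          (by fun_prop : Measurable fun z : Ω × ℝ => s k ^ 2 / (2 * |z.2|))).sub
          (((h3.pow_const 2).mul (by fun_prop : Measurable fun z : Ω × ℝ => |z.2|)).div_const 2))

variable {V : Type u} {G : SimpleGraph V} [G.LocallyFinite] {W : Sym2 V → ℝ}

lemma totalEnergy_eq (U : Finset V) {t : V → ℝ} (ht : ∀ i ∈ U, 0 ≤ t i) :
    totalEnergy G W U t =
      (1 / 2 * ∑ i ∈ U, ∑ j ∈ U, pairWeight G W i j * (√(1 + t i) * √(1 + t j)) +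
        ∑ i ∈ U, outerWeight G W U i * √(1 + t i)) -
      (1 / 2 * ∑ i ∈ U, ∑ j ∈ U, pairWeight G W i j + ∑ i ∈ U, outerWeight G W U i) := by
  rw [totalEnergy, innerEnergy_eq_sum_sum U ht, boundaryEnergy_eq_sum]
  simp only [mul_sub, mul_one, Finset.sum_sub_distrib]
  ring

/-- Existence of the field on a finite set of vertices. -/
lemma exists_integral_exp_eq_laplaceValue (hW : ∀ e ∈ G.edgeSet, 0 < W e) (U : Finset V) :
    ∃ (Ω : Type) (_ : MeasurableSpace Ω) (P : Measure Ω) (β : V → Ω → ℝ),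
      IsProbabilityMeasure P ∧ (∀ i, Measurable (β i)) ∧ (∀ i ω, 0 ≤ β i ω) ∧
      ∀ t : V → ℝ, (∀ i, 0 ≤ t i) →
        ∫ ω, Real.exp (-∑ i ∈ U, t i * β i ω) ∂P = laplaceValue G W U t := by
  obtain ⟨Ω, _, μ, β, Q, _, hβ, β_nonneg, hQ, -, -, key⟩ :=
    exists_lintegral_exp_eq (pairWeight_comm (G := G) (W := W)) pairWeight_self
      (pairWeight_nonneg hW) U
  set h : V → ℝ := outerWeight G W U
  set C : ℝ := 1 / 2 * ∑ i ∈ U, ∑ j ∈ U, pairWeight G W i j + ∑ i ∈ U, h i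
  have hh : 0 ≤ h := outerWeight_nonneg hW U
  have hm := hQ h h
  -- The external field is the conductance leaving U, the factor e^(-∑β) turns t into s² = 1 + t,
  -- and e^C makes the transform equal to 1 at t = 0.
  let D : Ω → ENNReal := fun ω =>
    ENNReal.ofReal (Real.exp (C - ∑ i ∈ U, β i ω - 1 / 2 * Q ω h h))
  have hD : Measurable D := by fun_prop
  have hlap : ∀ t : V → ℝ, (∀ i, 0 ≤ t i) →
      ∫⁻ ω, ENNReal.ofReal (Real.exp (-∑ i ∈ U, t i * β i ω)) ∂(μ.withDensity D) =
        ENNReal.ofReal (laplaceValue G W U t) := fun t ht => by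
    rw [lintegral_withDensity_eq_lintegral_mul _ hD (by fun_prop)]
    have e : ∀ ω, (D * fun ω => ENNReal.ofReal (Real.exp (-∑ i ∈ U, t i * β i ω))) ω =
        ENNReal.ofReal (Real.exp C) * ENNReal.ofReal
          (Real.exp (-∑ i ∈ U, √(1 + t i) ^ 2 * β i ω - 1 / 2 * Q ω h h)) := fun ω => by
      rw [Pi.mul_apply, ← ENNReal.ofReal_mul (by positivity), ← ENNReal.ofReal_mul (by positivity),
        ← Real.exp_add, ← Real.exp_add]
      congr 2
      have : ∑ i ∈ U, √(1 + t i) ^ 2 * β i ω = ∑ i ∈ U, β i ω + ∑ i ∈ U, t i * β i ω := by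
        rw [← Finset.sum_add_distrib]
        refine Finset.sum_congr rfl fun i _ => ?_
        rw [Real.sq_sqrt (by linarith [ht i])]
        ring
      rw [this]
      ring
    have hs : ∀ i, 0 < √(1 + t i) := fun i => Real.sqrt_pos.2 (by linarith [ht i])
    simp only [e]
    rw [lintegral_const_mul _ (by fun_prop), key _ h hs hh, ← ENNReal.ofReal_mul (by positivity),
      laplaceValue, totalEnergy_eq U fun i _ => ht i, ← mul_div_assoc,
      ← Real.exp_add, mul_one_div]
    congr 3
    ring
  refine ⟨Ω, inferInstance, μ.withDensity D, β, ⟨?_⟩, hβ, β_nonneg, fun t ht => ?_⟩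
  · have h0 := hlap 0 fun _ => le_rfl
    have e : laplaceValue G W U 0 = 1 := by
      rw [laplaceValue_eq_of_subset (Finset.empty_subset U) (by simp)]
      simp [laplaceValue, totalEnergy_empty]
    simpa [e] using h0
  · rw [integral_eq_lintegral_of_nonneg_ae (ae_of_all _ fun _ => (Real.exp_pos _).le)
      (Measurable.aestronglyMeasurable (by fun_prop)), hlap t ht, ENNReal.toReal_ofReal]
    unfold laplaceValue
    positivity

end BetaField

/-- The set `A n` of endpoints of walks of length n from a root is countable by local finiteness,
and these sets cover V. -/
lemma SimpleGraph.Connected.countable {V : Type u} {G : SimpleGraph V} [G.LocallyFinite]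
    (hG : G.Connected) : Countable V := by
  obtain ⟨r⟩ := hG.nonempty
  let A : ℕ → Set V := fun n => Nat.rec {r} (fun _ S => ⋃ i ∈ S, G.neighborSet i) n
  have hA : ∀ n, (A n).Countable := fun n => by
    induction n with
    | zero => exact Set.countable_singleton r
    | succ n ih => exact ih.biUnion fun i _ => (Set.toFinite _).countable
  have hmem : ∀ v, ∃ n, v ∈ A n := fun v => by
    have h := (G.reachable_iff_reflTransGen r v).1 (hG.preconnected r v)
    induction h with
    | refl => exact ⟨0, rfl⟩
    | tail _ hbc ih =>
      obtain ⟨n, hn⟩ := ih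
      exact ⟨n + 1, Set.mem_biUnion hn hbc⟩
  exact Set.countable_univ_iff.1 ((Set.countable_iUnion hA).mono fun v _ => Set.mem_iUnion.2 (hmem v))

/-! ### The one-vertex law -/

namespace BetaField

/-- The law of `1 / (2 β)` when the vertex has total conductance `a`: the inverse Gaussian law
`(1 / a, 1)` if `a > 0`, and its limit if `a = 0`. -/
noncomputable def reciprocalLaw (a : ℝ) : Measure ℝ :=
  (volume.restrict (Set.Ioi 0)).withDensity
    fun x => ENNReal.ofReal (Real.exp a * hittingKernel 1 a x)

/-- Expanding a²(x - 1/a)²/(2x) = a²x/2 - a + 1/(2x) explains the prefactor e^a. -/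
lemma inverseGaussianMeasure_eq {a : ℝ} (ha : 0 < a) :
    inverseGaussianMeasure (1 / a) 1 = reciprocalLaw a := by
  rw [inverseGaussianMeasure, reciprocalLaw, ← withDensity_indicator measurableSet_Ioi]
  congr 1
  funext x
  by_cases hx : 0 < x
  · rw [Set.indicator_of_mem (by exact hx), inverseGaussianPDFReal, if_pos hx, hittingKernel,
      mul_left_comm, ← Real.exp_add, Real.sqrt_div zero_le_one, Real.sqrt_one, one_div]
    congr 3
    field_simp
    ring
  · rw [Set.indicator_of_notMem (by exact hx), inverseGaussianPDFReal, if_neg hx,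
      ENNReal.ofReal_zero]

lemma ae_pos_reciprocalLaw (a : ℝ) : ∀ᵐ x ∂reciprocalLaw a, 0 < x :=
  (withDensity_absolutelyContinuous _ _).ae_le (ae_restrict_mem measurableSet_Ioi)

/-- The factor e^(-t/(2x)) merely changes p² = 1 into 1 + t in the hitting kernel. -/
lemma lintegral_reciprocalLaw {a t : ℝ} (ha : 0 ≤ a) (ht : 0 ≤ t) :
    ∫⁻ x, ENNReal.ofReal (Real.exp (-(t * (1 / (2 * x))))) ∂reciprocalLaw a =
      ENNReal.ofReal (Real.exp (-(a * (√(1 + t) - 1))) / √(1 + t)) := by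
  rw [reciprocalLaw, lintegral_withDensity_eq_lintegral_mul _ (by fun_prop) (by fun_prop)]
  have e : ∀ x ∈ Set.Ioi (0 : ℝ), ((fun x => ENNReal.ofReal (Real.exp a * hittingKernel 1 a x)) *
      fun x => ENNReal.ofReal (Real.exp (-(t * (1 / (2 * x)))))) x =
      ENNReal.ofReal (Real.exp a) * ENNReal.ofReal (hittingKernel (√(1 + t)) a x) :=
    fun x (hx : 0 < x) => by
      have := hittingKernel_nonneg 1 a x
      rw [Pi.mul_apply, ← ENNReal.ofReal_mul (by positivity),
        ← ENNReal.ofReal_mul (by positivity), hittingKernel, hittingKernel, mul_assoc, mul_assoc,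
        ← Real.exp_add, Real.sq_sqrt (by linarith)]
      congr 4
      field_simp
      ring
  have hs : 0 < √(1 + t) := Real.sqrt_pos.2 (by linarith)
  rw [setLIntegral_congr_fun measurableSet_Ioi e, lintegral_const_mul _ (by fun_prop),
    lintegral_hittingKernel hs ha, ← ENNReal.ofReal_mul (by positivity), ← mul_div_assoc,
    ← Real.exp_add]
  congr 3
  ring

lemma isProbabilityMeasure_reciprocalLaw {a : ℝ} (ha : 0 ≤ a) :
    IsProbabilityMeasure (reciprocalLaw a) :=
  ⟨by simpa using lintegral_reciprocalLaw ha le_rfl⟩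

lemma integral_reciprocalLaw {a t : ℝ} (ha : 0 ≤ a) (ht : 0 ≤ t) :
    ∫ x, Real.exp (-(t * (1 / (2 * x)))) ∂reciprocalLaw a =
      Real.exp (-(a * (√(1 + t) - 1))) / √(1 + t) := by
  rw [integral_eq_lintegral_of_nonneg_ae (ae_of_all _ fun _ => (Real.exp_pos _).le)
    (Measurable.aestronglyMeasurable (by fun_prop)), lintegral_reciprocalLaw ha ht,
    ENNReal.toReal_ofReal (by positivity)]

variable {V : Type u} {G : SimpleGraph V} [G.LocallyFinite] {W : Sym2 V → ℝ}

lemma vertexWeight_nonneg (hW : ∀ e ∈ G.edgeSet, 0 < W e) (i : V) : 0 ≤ vertexWeight G W i :=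
  Finset.sum_nonneg fun j hj => (hW _ (by simpa using hj)).le

lemma vertexWeight_pos (hW : ∀ e ∈ G.edgeSet, 0 < W e) {i : V} (hi : ∃ j, G.Adj i j) :
    0 < vertexWeight G W i :=
  Finset.sum_pos (fun j hj => hW _ (by simpa using hj)) (by simpa [Finset.Nonempty] using hi)

/-! ### Uniqueness, marginals and 1-dependence -/

namespace IsBetaField

variable {Ω : Type*} [MeasurableSpace Ω] {P : Measure Ω} {β : V → Ω → ℝ}

lemma integral_exp_eq (h : IsBetaField G W P β) {U : Finset V} {t : V → ℝ}
    (ht : ∀ i ∈ U, 0 ≤ t i) :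
    ∫ ω, Real.exp (-∑ i ∈ U, t i * β i ω) ∂P = laplaceValue G W U t := by
  rw [h.laplace U t ht, laplaceValue_eq]

lemma map_eq_map [Countable V] [IsProbabilityMeasure P] {Ω' : Type*} [MeasurableSpace Ω']
    {P' : Measure Ω'} [IsProbabilityMeasure P'] {β' : V → Ω' → ℝ} (h : IsBetaField G W P β)
    (h' : IsBetaField G W P' β') :
    P.map (fun ω i => β i ω) = P'.map (fun ω i => β' i ω) :=
  map_eq_of_integral_exp_eq h.measurable h'.measurable
    (fun i => (h.pos i).mono fun _ => le_of_lt) (fun i => (h'.pos i).mono fun _ => le_of_lt)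
    fun s t ht => by
      rw [h.integral_exp_eq fun i _ => ht i, h'.integral_exp_eq fun i _ => ht i]

lemma inverseGaussianMarginals [IsProbabilityMeasure P] (hW : ∀ e ∈ G.edgeSet, 0 < W e)
    (h : IsBetaField G W P β) : InverseGaussianMarginals G W P β := by
  intro i hi
  have hw := vertexWeight_pos hW hi
  have := isProbabilityMeasure_reciprocalLaw hw.le
  have hβ := h.measurable i
  refine ⟨by fun_prop, ?_⟩
  have key : P.map (fun ω (_ : Unit) => β i ω) =
      (reciprocalLaw (vertexWeight G W i)).map (fun x (_ : Unit) => 1 / (2 * x)) := by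
    refine map_eq_of_integral_exp_eq (β := fun _ => β i) (β' := fun _ x => 1 / (2 * x))
      (fun _ => hβ) (fun _ => by fun_prop) (fun _ => (h.pos i).mono fun _ => le_of_lt)
      (fun _ => (ae_pos_reciprocalLaw _).mono fun x hx => by positivity) fun s t ht => ?_
    have e1 := h.integral_exp_eq (U := {i}) (t := fun _ => ∑ k ∈ s, t k)
      fun _ _ => Finset.sum_nonneg fun k _ => ht k
    have e2 := integral_reciprocalLaw hw.le (Finset.sum_nonneg fun k (_ : k ∈ s) => ht k)
    simp only [Finset.sum_singleton, laplaceValue_singleton] at e1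
    simp only [← Finset.sum_mul]
    rw [e1, e2]
  have e := congrArg (Measure.map fun y : Unit → ℝ => 1 / (2 * y ())) key
  rw [Measure.map_map (by fun_prop) (by fun_prop), Measure.map_map (by fun_prop) (by fun_prop)] at e
  rw [inverseGaussianMeasure_eq hw]
  refine e.trans ?_
  -- The map x ↦ 1/(2x) is an involution, also at 0 where it takes the value 0.
  have : ((fun y : Unit → ℝ => 1 / (2 * y ())) ∘ fun x (_ : Unit) => 1 / (2 * x)) = id := by
    funext x
    simp only [Function.comp_apply, id]
    rcases eq_or_ne x 0 with rfl | hx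
    · simp
    · field_simp
  rw [this, Measure.map_id]

lemma oneDependent [Countable V] [IsProbabilityMeasure P] (h : IsBetaField G W P β) :
    OneDependent G P β := by
  classical
  intro U U' hU
  have hdist : ∀ i ∈ U, ∀ j ∈ U', 2 ≤ G.edist i j := fun i hi j hj =>
    hU.trans ((iInf₂_le i hi).trans (iInf₂_le j hj))
  have hne : ∀ i ∈ U, i ∉ U' := fun i hi hi' => by
    simpa using hdist i hi i hi'
  have hadj : ∀ i ∈ U, ∀ j ∈ U', ¬ G.Adj i j := fun i hi j hj hij => by
    have := hdist i hi j hj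
    rw [SimpleGraph.edist_eq_one_iff_adj.2 hij] at this
    exact absurd this (by decide)
  have hβ := h.measurable
  rw [indepFun_iff_map_prod_eq_prod_map_map (by fun_prop) (by fun_prop),
    Measure.map_prod_map _ _ (by fun_prop) (by fun_prop)]
  -- The joint law is compared with that of two independent copies, one read on U and the other on
  -- U'. Indexing by the disjoint sum lets the uniqueness theorem treat infinite sets as well.
  have key : P.map (fun ω (k : U ⊕ U') => Sum.elim (fun i : U => β i ω) (fun j : U' => β j ω) k) =
      (P.prod P).map (fun (z : Ω × Ω) (k : U ⊕ U') =>
        Sum.elim (fun i : U => β i z.1) (fun j : U' => β j z.2) k) := by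
    refine map_eq_of_integral_exp_eq
      (β := fun (k : U ⊕ U') ω => Sum.elim (fun i : U => β i ω) (fun j : U' => β j ω) k)
      (β' := fun (k : U ⊕ U') (z : Ω × Ω) => Sum.elim (fun i : U => β i z.1) (fun j : U' => β j z.2) k)
      ?_ ?_ ?_ ?_ fun s t ht => ?_
    · rintro (i | j) <;> exact hβ _
    · rintro (i | j)
      · exact (hβ _).comp measurable_fst
      · exact (hβ _).comp measurable_snd
    · rintro (i | j) <;> exact (h.pos _).mono fun _ => le_of_lt
    · rintro (i | j)
      · exact (Measure.quasiMeasurePreserving_fst.ae (h.pos i)).mono fun _ => le_of_lt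
      · exact (Measure.quasiMeasurePreserving_snd.ae (h.pos j)).mono fun _ => le_of_lt
    · let T : V → ℝ := fun v => if hv : v ∈ U then t (Sum.inl ⟨v, hv⟩) else
        if hv : v ∈ U' then t (Sum.inr ⟨v, hv⟩) else 0
      have hT : ∀ v, 0 ≤ T v := fun v => by
        simp only [T]
        split_ifs
        exacts [ht _, ht _, le_rfl]
      have hTl : ∀ i : U, T i = t (Sum.inl i) := fun i => by simp [T]
      have hTr : ∀ j : U', T j = t (Sum.inr j) := fun j => by
        simp [T, show (j : V) ∉ U from fun hj => hne _ hj j.2]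
      let A : Finset V := s.toLeft.map (Function.Embedding.subtype _)
      let B : Finset V := s.toRight.map (Function.Embedding.subtype _)
      have hA : ∀ i ∈ A, i ∈ U := fun i hi => by
        obtain ⟨j, _, rfl⟩ := Finset.mem_map.1 hi; exact j.2
      have hB : ∀ i ∈ B, i ∈ U' := fun i hi => by
        obtain ⟨j, _, rfl⟩ := Finset.mem_map.1 hi; exact j.2
      have hAB : Disjoint A B := Finset.disjoint_left.2 fun i hi hi' => hne i (hA i hi) (hB i hi')
      have hsum : ∀ x y : V → ℝ, ∑ k ∈ s, t k * Sum.elim (fun i : U => x i) (fun j : U' => y j) k =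
          ∑ i ∈ A, T i * x i + ∑ j ∈ B, T j * y j := fun x y => by
        rw [← Finset.toLeft_disjSum_toRight (u := s), Finset.sum_disjSum]
        simp [A, B, Finset.sum_map, hTl, hTr]
      have e1 : ∀ ω, ∑ k ∈ s, t k * Sum.elim (fun i : U => β i ω) (fun j : U' => β j ω) k =
          ∑ i ∈ A ∪ B, T i * β i ω := fun ω => by
        rw [Finset.sum_union hAB]
        exact hsum (fun i => β i ω) (fun i => β i ω)
      have e2 : ∀ z : Ω × Ω,
          ∑ k ∈ s, t k * Sum.elim (fun i : U => β i z.1) (fun j : U' => β j z.2) k =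
          ∑ i ∈ A, T i * β i z.1 + ∑ j ∈ B, T j * β j z.2 := fun z =>
        hsum (fun i => β i z.1) (fun i => β i z.2)
      simp only [e1, e2, neg_add, Real.exp_add]
      rw [h.integral_exp_eq fun i _ => hT i,
        integral_prod_mul (fun ω => Real.exp (-∑ i ∈ A, T i * β i ω))
          (fun ω => Real.exp (-∑ i ∈ B, T i * β i ω)),
        h.integral_exp_eq fun i _ => hT i, h.integral_exp_eq fun i _ => hT i,
        laplaceValue_union_of_not_adj T hAB fun i hi j hj => hadj i (hA i hi) j (hB j hj)]
  have hm1 : Measurable fun ω (k : U ⊕ U') =>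
      Sum.elim (fun i : U => β i ω) (fun j : U' => β j ω) k :=
    measurable_pi_lambda _ (by rintro (i | j) <;> exact hβ _)
  have hm2 : Measurable fun (z : Ω × Ω) (k : U ⊕ U') =>
      Sum.elim (fun i : U => β i z.1) (fun j : U' => β j z.2) k :=
    measurable_pi_lambda _ (by
      rintro (i | j)
      · exact (hβ _).comp measurable_fst
      · exact (hβ _).comp measurable_snd)
  have e := congrArg (Measure.map fun x : U ⊕ U' → ℝ =>
    ((fun i : U => x (Sum.inl i)), (fun j : U' => x (Sum.inr j)))) key
  rw [Measure.map_map (by fun_prop) hm1, Measure.map_map (by fun_prop) hm2] at e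
  exact e

end IsBetaField

/-! ### Existence on the whole graph -/

open Filter Topology in
/-- Weak limit, along the finite sets of vertices, of the laws of the fields on finite sets, in the
coordinates `exp (-β)`. -/
lemma exists_measure_unitInterval [Countable V] (hW : ∀ e ∈ G.edgeSet, 0 < W e) :
    ∃ ν : Measure (V → unitInterval), IsProbabilityMeasure ν ∧
      ∀ (U : Finset V) (t : V → ℝ), (∀ i ∈ U, 0 ≤ t i) →
        ∫ y, ∏ i ∈ U, (y i : ℝ) ^ t i ∂ν = laplaceValue G W U t := by
  classical
  choose Ω mΩ P β hP hβ β_nonneg key using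
    exists_integral_exp_eq_laplaceValue (G := G) (W := W) hW
  have hm : ∀ U, Measurable fun ω i => expNeg (β U i ω) := fun U =>
    measurable_pi_lambda _ fun i => measurable_expNeg.comp (hβ U i)
  let μ : Finset V → ProbabilityMeasure (V → unitInterval) := fun U =>
    ⟨(P U).map fun ω i => expNeg (β U i ω),
      Measure.isProbabilityMeasure_map (hm U).aemeasurable⟩
  -- By compactness the finite laws converge along an ultrafilter finer than `atTop`. Each test
  -- integral below is constant once U' ⊇ U, so its limit is known.
  let F : Ultrafilter (Finset V) := Ultrafilter.of atTop
  obtain ⟨ν, -, hν⟩ := isCompact_univ.ultrafilter_le_nhds (F.map μ) (by simp)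
  have hν' : Tendsto μ F (𝓝 ν) := hν
  refine ⟨ν, inferInstance, fun U t ht => ?_⟩
  have hcont : Continuous fun y : V → unitInterval => ∏ i ∈ U, (y i : ℝ) ^ t i :=
    continuous_finsetProd _ fun i hi =>
      Continuous.rpow_const (by fun_prop) fun _ => Or.inr (ht i hi)
  let f : BoundedContinuousFunction (V → unitInterval) ℝ :=
    BoundedContinuousFunction.mkOfCompact ⟨_, hcont⟩
  have hlim := (ProbabilityMeasure.tendsto_iff_forall_integral_tendsto.1 hν') f
  refine tendsto_nhds_unique hlim (tendsto_const_nhds.congr' ?_)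
  filter_upwards [Ultrafilter.of_le _ (eventually_ge_atTop U)] with U' (hU : U ⊆ U')
  let t' : V → ℝ := fun i => if i ∈ U then t i else 0
  have ht' : ∀ i, 0 ≤ t' i := fun i => by
    simp only [t']
    split_ifs with hi
    exacts [ht i hi, le_rfl]
  have e := key U' t' ht'
  rw [laplaceValue_eq_of_subset hU fun i _ hi => by simp [t', hi],
    laplaceValue_congr (t' := t) fun i hi => by simp [t', hi]] at e
  rw [← e]
  change _ = ∫ y, ∏ i ∈ U, (y i : ℝ) ^ t i ∂((P U').map fun ω i => expNeg (β U' i ω))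
  rw [integral_map (hm U').aemeasurable hcont.measurable.aestronglyMeasurable]
  refine integral_congr_ae (ae_of_all _ fun ω => ?_)
  simp only [← Finset.sum_neg_distrib, Real.exp_sum]
  rw [← Finset.prod_subset hU fun i _ hi => by simp [t', hi]]
  refine Finset.prod_congr rfl fun i hi => ?_
  rw [coe_expNeg (β_nonneg U' i ω), ← Real.exp_mul]
  simp only [t', if_pos hi]
  ring_nf

/-- Existence of the field on an infinite graph. -/
lemma exists_isBetaField [Countable V] (hW : ∀ e ∈ G.edgeSet, 0 < W e) :
    ∃ ν : Measure (V → ℝ), IsProbabilityMeasure ν ∧ IsBetaField G W ν fun i x => x i := by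
  obtain ⟨ν, _, hν⟩ := exists_measure_unitInterval (G := G) (W := W) hW
  -- The limit might charge 0 or 1, that is β = ∞ or β = 0. Identifying each marginal by its moments
  -- excludes this. `reciprocalLaw` also covers an isolated vertex, where W_i = 0.
  have hlaw : ∀ i, ν.map (fun y (_ : Unit) => y i) =
      (reciprocalLaw (vertexWeight G W i)).map (fun x _ => expNeg (1 / (2 * x))) := fun i => by
    have hw := vertexWeight_nonneg hW i
    have := isProbabilityMeasure_reciprocalLaw hw
    have hm : Measurable fun (y : V → unitInterval) (_ : Unit) => y i := by fun_prop
    have hm' : Measurable fun (x : ℝ) (_ : Unit) => expNeg (1 / (2 * x)) := by fun_prop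
    have := Measure.isProbabilityMeasure_map (μ := ν) hm.aemeasurable
    have := Measure.isProbabilityMeasure_map (μ := reciprocalLaw (vertexWeight G W i))
      hm'.aemeasurable
    refine ext_of_integral_prod_pow fun n => ?_
    have hc : Measurable fun y : Unit → unitInterval => n.prod (fun i k => (y i : ℝ) ^ k) := by
      unfold Finsupp.prod; fun_prop
    rw [integral_map hm.aemeasurable hc.aestronglyMeasurable,
      integral_map hm'.aemeasurable hc.aestronglyMeasurable]
    have e1 := hν {i} (fun _ => (n () : ℝ)) fun _ _ => Nat.cast_nonneg _
    have e2 := integral_reciprocalLaw hw (Nat.cast_nonneg (n ()))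
    simp only [Finset.prod_singleton, laplaceValue_singleton, Real.rpow_natCast] at e1
    have hprod : ∀ g : Unit → ℝ, n.prod (fun i k => g i ^ k) = g () ^ n () := fun g => by
      rw [Finsupp.prod_fintype _ _ (by simp)]
      simp
    simp only [hprod]
    rw [e1, ← e2]
    refine integral_congr_ae ((ae_pos_reciprocalLaw _).mono fun x hx => ?_)
    simp only
    rw [coe_expNeg (by positivity), ← Real.exp_nat_mul]
    ring_nf
  have hpos : ∀ i, ∀ᵐ y ∂ν, 0 < (y i : ℝ) ∧ (y i : ℝ) < 1 := fun i => by
    have hs : MeasurableSet {z : Unit → unitInterval | 0 < (z () : ℝ) ∧ (z () : ℝ) < 1} :=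
      (by fun_prop : Measurable fun z : Unit → unitInterval => (z () : ℝ)) measurableSet_Ioo
    have h := (ae_map_iff (μ := reciprocalLaw (vertexWeight G W i))
      (f := fun x (_ : Unit) => expNeg (1 / (2 * x))) (by fun_prop) hs).2 ?_
    · rw [← hlaw i] at h
      exact (ae_map_iff (measurable_pi_lambda _ fun _ => measurable_pi_apply i).aemeasurable hs).1 h
    · filter_upwards [ae_pos_reciprocalLaw _] with x hx
      rw [coe_expNeg (by positivity)]
      exact ⟨Real.exp_pos _, Real.exp_lt_one_iff.2 (neg_lt_zero.2 (by positivity))⟩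
  have hm : Measurable fun (y : V → unitInterval) i => -Real.log (y i) := by fun_prop
  refine ⟨ν.map fun y i => -Real.log (y i), Measure.isProbabilityMeasure_map hm.aemeasurable,
    fun i => by fun_prop, fun i => ?_, fun U t ht => ?_⟩
  · rw [ae_map_iff hm.aemeasurable (measurableSet_lt (by fun_prop) (by fun_prop))]
    filter_upwards [hpos i] with y hy
    exact neg_pos.2 (Real.log_neg hy.1 hy.2)
  · rw [← laplaceValue_eq, ← hν U t ht, integral_map hm.aemeasurable
      (Measurable.aestronglyMeasurable (by fun_prop))]
    refine integral_congr_ae ?_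
    filter_upwards [ae_all_iff.2 hpos] with y hy
    rw [← Finset.sum_neg_distrib, Real.exp_sum]
    refine Finset.prod_congr rfl fun i _ => ?_
    rw [Real.rpow_def_of_pos (hy i).1]
    ring_nf

end BetaField

theorem proposition1 {V : Type u} (G : SimpleGraph V) [G.LocallyFinite] (hG : G.Connected)
    (W : Sym2 V → ℝ) (hW : ∀ e ∈ G.edgeSet, 0 < W e) :
    ∃ ν : Measure (V → ℝ), IsProbabilityMeasure ν ∧
      -- existence: the coordinate field under ν
      BetaField.IsBetaField G W ν (fun i x => x i) ∧
      BetaField.OneDependent G ν (fun i x => x i) ∧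
      BetaField.InverseGaussianMarginals G W ν (fun i x => x i) ∧
      -- the Laplace transforms determine the law, and imply the two properties, for any such family
      ∀ (Ω : Type v) [MeasurableSpace Ω] (P : Measure Ω) [IsProbabilityMeasure P]
        (β : V → Ω → ℝ), BetaField.IsBetaField G W P β →
          HasLaw (fun ω i => β i ω) ν P ∧
          BetaField.OneDependent G P β ∧
          BetaField.InverseGaussianMarginals G W P β := by
  have := hG.countable
  obtain ⟨ν, hprob, hν⟩ := BetaField.exists_isBetaField (G := G) (W := W) hW
  refine ⟨ν, hprob, hν, hν.oneDependent, hν.inverseGaussianMarginals hW,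
    fun Ω _ P _ β hβ => ⟨⟨?_, ?_⟩, hβ.oneDependent, hβ.inverseGaussianMarginals hW⟩⟩
  · exact (measurable_pi_lambda _ hβ.measurable).aemeasurable
  · exact (hβ.map_eq_map hν).trans Measure.map_id
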